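/- Let $Q(x)=3\,\mathrm{ch}^{-2}(x/2)$ and, for $c>0$, $Q_c(x)=cQ(\sqrt c\,x)$, $x\in\mathbb R$. Let $\partial_x^{-1}$ denote the Fourier multiplier with symbol $(i\xi)^{-1}$. For $k\in\mathbb Z\setminus\{0\}$ and $f_1,f_2\in H^1(\mathbb R)$ (real- or complex-valued) with $\partial_x^{-1}f_1,\partial_x^{-1}f_2\in L^2(\mathbb R)$, set $$ B_k^c(f_1,f_2)=2\,\mathrm{Re}\int_{-\infty}^{\infty}\Big[f_1'\,\overline{f_2'}+k^2(\partial_x^{-1}f_1)\overline{(\partial_x^{-1}f_2)}+c f_1\overline{f_2}-Q_c f_1\overline{f_2}\Big]dx . $$ Then for every $c_0<4/\sqrt3$ there exists $C>0$, depending only on $c_0$, such that for every $c$ with $0<c\le c_0$, every $k\in\mathbb Z\setminus\{0\}$ and every $f\in H^1(\mathbb R)$ with $\partial_x^{-1}f\in L^2(\mathbb R)$, $$ B_k^c(f,f)\ \ge\ C\Big(\|f\|_{H^1}^2+k^2\|\partial_x^{-1}f\|_{L^2}^2\Big),\qquad \|f\|_{H^1}^2=\|f\|_{L^2}^2+\|f'\|_{L^2}^2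 . $$ In particular, for each fixed $c\in(0,4/\sqrt3)$ the form $B_k^c$ is coercive with a constant uniform in $k\ne0$. -/

import Mathlib

open MeasureTheory FourierTransform
open scoped SchwartzMap LineDeriv

noncomputable section

namespace KPI

/-- The complex Hilbert space `L²(ℝ)`. -/
abbrev L2 : Type := Lp (α := ℝ) ℂ 2

/-- The KdV soliton profile `Q(x) = 3 ch⁻²(x/2)`. -/
def Q (x : ℝ) : ℝ := 3 / Real.cosh (x / 2) ^ 2

/-- The rescaled profile `Q_c(x) = c Q(√c x)`. -/
def Qc (c x : ℝ) : ℝ := c * Q (Real.sqrt c * x)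

/-- `f ∈ H¹(ℝ)`. -/
def MemH1 (f : L2) : Prop :=
  TemperedDistribution.MemSobolev 1 2 (f : 𝓢'(ℝ, ℂ))

open scoped Classical in
/-- The derivative `f' ∈ L²(ℝ)`: the element of `L²` that represents the distributional derivative
of `f` (and `0` if there is none, which does not happen for `f ∈ H¹`). -/
def dx (f : L2) : L2 :=
  if h : ∃ g : L2, (g : 𝓢'(ℝ, ℂ)) = ∂_{(1 : ℝ)} (f : 𝓢'(ℝ, ℂ)) then h.choose else 0

/-- For `f ∈ H¹`, `dx f` is indeed the distributional derivative of `f`. -/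
theorem dx_spec {f : L2} (hf : MemH1 f) :
    (dx f : 𝓢'(ℝ, ℂ)) = ∂_{(1 : ℝ)} (f : 𝓢'(ℝ, ℂ)) := by
  have h : ∃ g : L2, (g : 𝓢'(ℝ, ℂ)) = ∂_{(1 : ℝ)} (f : 𝓢'(ℝ, ℂ)) := by
    have h0 := TemperedDistribution.MemSobolev.lineDerivOp hf (m := (1 : ℝ))
    rw [sub_self, TemperedDistribution.memSobolev_zero_iff] at h0
    obtain ⟨g, hg⟩ := h0
    exact ⟨g, hg.symm⟩
  rw [dx, dif_pos h]
  exact h.choose_spec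

/-- The Fourier transform of `∂ₓ⁻¹ f`. With the normalization
`𝓕 f(ξ) = ∫ exp(-2πi x ξ) f(x) dx` the symbol of `∂ₓ` is `2πiξ`, so that of `∂ₓ⁻¹` is
`(2πiξ)⁻¹`. -/
def dxInvSymbol (f : L2) (ξ : ℝ) : ℂ :=
  (2 * (Real.pi : ℂ) * Complex.I * (ξ : ℂ))⁻¹ * (𝓕 f : L2) ξ

/-- `∂ₓ⁻¹ f ∈ L²(ℝ)`. -/
def HasDxInv (f : L2) : Prop :=
  MemLp (dxInvSymbol f) 2 volume

open scoped Classical in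
/-- The antiderivative `∂ₓ⁻¹ f`, the Fourier multiplier with symbol `(2πiξ)⁻¹` applied to `f`
(and `0` if the result is not in `L²`). -/
def dxInv (f : L2) : L2 :=
  if h : HasDxInv f then 𝓕⁻ (h.toLp (dxInvSymbol f)) else 0

/-- The symmetric form
`B_k^c(f₁,f₂) = 2 ∫ [f₁' f₂' + k² (∂ₓ⁻¹f₁)(∂ₓ⁻¹f₂) + c f₁ f₂ - Q_c f₁ f₂] dx`,
where for complex-valued functions a product `a b` is read as `Re (a b̄)`, so that
`B_k^c(f,f) = 2 ∫ [|f'|² + k² |∂ₓ⁻¹f|² + c |f|² - Q_c |f|²] dx`. -/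
def B (c : ℝ) (k : ℤ) (f₁ f₂ : L2) : ℝ :=
  2 * ∫ x : ℝ,
    ((dx f₁ x * star (dx f₂ x)).re
      + (k : ℝ) ^ 2 * (dxInv f₁ x * star (dxInv f₂ x)).re
      + c * (f₁ x * star (f₂ x)).re
      - Qc c x * (f₁ x * star (f₂ x)).re)

/-- The square of the `H¹` norm. -/
def normH1Sq (f : L2) : ℝ := ‖f‖ ^ 2 + ‖dx f‖ ^ 2

end KPI

end

/-!
Write `g = ∂ₓ⁻¹f`. By scaling, `B_k^c` is governed by `∫ |g''|² + (1 - Q) |g'|² + μ |g|²` with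
`μ = k²/c²`, and `c < 4/√3`, `k ≠ 0` imply `μ > 3/16`. At the critical value `μ = 3/16` the
corresponding fourth-order operator factors as `A* A` with `A = ∂ₓ² + a ∂ₓ + b`: up to an exact
derivative, the density of the form is `|g'' + a g' + b g|²`. The coefficients are rational
functions of `t = tanh(x/2)`. They come from the two explicit solutions of the critical equation
that decay at `-∞`, which span the kernel of `A`; they are bounded because the Wronskian of these
solutions is a nonvanishing multiple of `t² - √3 t + 1 > 0`. The identities are `coefA_riccati`,
`coefB_riccati` and `coefA_mul_coefB`, and `integral_nonneg_of_sq_factorization` derives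
nonnegativity of the form on Schwartz functions from them.

The passage to `f ∈ H¹` with `∂ₓ⁻¹f ∈ L²` is by density (`mem_closure_schwartz`): the function
`Ψ = g - g''` lies in `L²`, the operators `∂ₓⁿ (1 - ∂ₓ²)⁻¹`, `n = 0, 1, 2`, are bounded Fourier
multipliers that preserve Schwartz functions, and they send `Ψ` to `g`, `f`, `f'`.

For `c ≤ c₀ < 4/√3` the form exceeds the critical one by at least `δ k² ‖∂ₓ⁻¹f‖²` with
`δ = 1 - 3c₀²/16`. A small fraction of the critical form controls `‖f'‖² - 2c₀ ‖f‖²`, and the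
interpolation of `‖f‖²` between `‖f'‖²` and `‖∂ₓ⁻¹f‖²` (`norm_sq_le_interpolation`, which is the
factorization argument with `a = 0` and constant `b`) completes the bound.
-/

noncomputable section

namespace KPI

/-! ### Multiplication operators and Fourier multipliers on `L²` -/

/-- Multiplication of an `L²` function by a bounded function `m`. -/
def mulCLM (m : ℝ → ℂ) (hm : MemLp m ⊤ volume) : L2 →L[ℂ] L2 :=
  (ContinuousLinearMap.mul ℂ ℂ).holderL volume ⊤ 2 2 (hm.toLp m)

theorem coeFn_mulCLM {m : ℝ → ℂ} (hm : MemLp m ⊤ volume) (u : L2) :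
    mulCLM m hm u =ᵐ[volume] fun x => m x * u x := by
  filter_upwards [(ContinuousLinearMap.mul ℂ ℂ).coeFn_holder (r := 2) (hm.toLp m) u, hm.coeFn_toLp]
    with x h1 h2
  rw [← h2]
  exact h1

theorem mulCLM_toLp {m : ℝ → ℂ} (hm : MemLp m ⊤ volume) (hm' : m.HasTemperateGrowth)
    (ψ : 𝓢(ℝ, ℂ)) :
    mulCLM m hm (ψ.toLp 2) = (SchwartzMap.smulLeftCLM ℂ m ψ).toLp 2 := by
  refine Lp.ext ?_
  filter_upwards [coeFn_mulCLM hm (ψ.toLp 2), ψ.coeFn_toLp 2 volume,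
    (SchwartzMap.smulLeftCLM ℂ m ψ).coeFn_toLp 2 volume] with x h1 h2 h3
  rw [h1, h2, h3, SchwartzMap.smulLeftCLM_apply_apply hm', smul_eq_mul]

theorem toTemperedDistribution_mulCLM {m : ℝ → ℂ} (hm : MemLp m ⊤ volume)
    (hm' : m.HasTemperateGrowth) (u : L2) :
    (mulCLM m hm u : 𝓢'(ℝ, ℂ)) = TemperedDistribution.smulLeftCLM ℂ m (u : 𝓢'(ℝ, ℂ)) := by
  rw [← Lp.toTemperedDistribution_smul_eq (r := 2) hm' hm]
  congr 1

theorem toTemperedDistribution_injective {u v : L2} (h : (u : 𝓢'(ℝ, ℂ)) = v) : u = v :=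
  LinearMap.ker_eq_bot.1 (Lp.ker_toTemperedDistributionCLM_eq_bot (F := ℂ)
    (μ := (volume : Measure ℝ)) (p := 2)) h

/-- The symbol `(1 + (2πξ)²)⁻¹` of `(1 - ∂ₓ²)⁻¹`. -/
def resSymbol (ξ : ℝ) : ℂ := (((1 + ‖2 * Real.pi * ξ‖ ^ 2) ^ (-1 : ℝ) : ℝ) : ℂ)

theorem resSymbol_eq (ξ : ℝ) : resSymbol ξ = (1 + (2 * Real.pi * ξ) ^ 2 : ℂ)⁻¹ := by
  rw [resSymbol, Real.rpow_neg_one, Real.norm_eq_abs, sq_abs]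
  push_cast; rfl

/-- The symbol `2πiξ` of `∂ₓ`. -/
def dSymbol (ξ : ℝ) : ℂ := 2 * Real.pi * Complex.I * ξ

theorem hasTemperateGrowth_dSymbol : dSymbol.HasTemperateGrowth := by
  unfold dSymbol; fun_prop

theorem hasTemperateGrowth_resSymbol : resSymbol.HasTemperateGrowth := by
  have h : (fun ξ : ℝ => (1 + ‖2 * Real.pi * ξ‖ ^ 2) ^ (-1 : ℝ)).HasTemperateGrowth :=
    (Function.hasTemperateGrowth_one_add_norm_sq_rpow (H := ℝ) (-1)).comp
      (f := fun ξ : ℝ => 2 * Real.pi * ξ) (by fun_prop)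
  exact Function.HasTemperateGrowth.comp Function.Complex.hasTemperateGrowth_ofReal h

theorem hasTemperateGrowth_symbol (n : ℕ) :
    (fun ξ => dSymbol ξ ^ n * resSymbol ξ).HasTemperateGrowth :=
  (hasTemperateGrowth_dSymbol.pow n).mul hasTemperateGrowth_resSymbol

theorem norm_symbol_le {n : ℕ} (hn : n ≤ 2) (ξ : ℝ) : ‖dSymbol ξ ^ n * resSymbol ξ‖ ≤ 1 := by
  have h1 : ‖dSymbol ξ‖ = |2 * Real.pi * ξ| := by
    simp [dSymbol, abs_mul]
  have h2 : ‖resSymbol ξ‖ = (1 + |2 * Real.pi * ξ| ^ 2)⁻¹ := by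
    rw [resSymbol, Real.rpow_neg_one, Complex.norm_real, Real.norm_of_nonneg (by positivity),
      Real.norm_eq_abs]
  rw [norm_mul, norm_pow, h1, h2, mul_inv_le_iff₀ (by positivity), one_mul]
  set y := |2 * Real.pi * ξ|
  have hy : 0 ≤ y := abs_nonneg _
  interval_cases n <;> nlinarith [sq_nonneg (y - 1)]

theorem memLp_symbol {n : ℕ} (hn : n ≤ 2) :
    MemLp (fun ξ => dSymbol ξ ^ n * resSymbol ξ) ⊤ volume :=
  memLp_top_of_bound (hasTemperateGrowth_symbol n).1.continuous.aestronglyMeasurable 1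
    (Filter.Eventually.of_forall (norm_symbol_le hn))

/-- `∂ₓⁿ (1 - ∂ₓ²)⁻¹` as a bounded operator on `L²`, for `n ≤ 2`. -/
def dRes (n : ℕ) (hn : n ≤ 2) : L2 →L[ℂ] L2 :=
  (fourierInvCLM ℂ L2) ∘L (mulCLM _ (memLp_symbol hn)) ∘L (fourierCLM ℂ L2)

/-! ### Density of Schwartz functions -/

theorem dRes_apply {n : ℕ} (hn : n ≤ 2) (u : L2) :
    dRes n hn u = 𝓕⁻ (mulCLM _ (memLp_symbol hn) (𝓕 u)) := rfl

/-- `(1 - ∂ₓ²)⁻¹ ψ` for a Schwartz function `ψ`. -/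
def resSchwartz (ψ : 𝓢(ℝ, ℂ)) : 𝓢(ℝ, ℂ) := 𝓕⁻ (SchwartzMap.smulLeftCLM ℂ resSymbol (𝓕 ψ))

theorem lineDerivOp_fourierInv (χ : 𝓢(ℝ, ℂ)) :
    ∂_{(1 : ℝ)} (𝓕⁻ χ) = 𝓕⁻ (SchwartzMap.smulLeftCLM ℂ dSymbol χ) := by
  rw [SchwartzMap.lineDerivOp_fourierInv_eq]
  congr 1
  ext ξ
  rw [smul_apply, SchwartzMap.smulLeftCLM_apply_apply (by fun_prop),
    SchwartzMap.smulLeftCLM_apply_apply hasTemperateGrowth_dSymbol]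
  simp [dSymbol, mul_assoc]

theorem iterate_lineDerivOp_resSchwartz (n : ℕ) (ψ : 𝓢(ℝ, ℂ)) :
    (fun φ : 𝓢(ℝ, ℂ) => (∂_{(1 : ℝ)} φ : 𝓢(ℝ, ℂ)))^[n] (resSchwartz ψ) =
      𝓕⁻ (SchwartzMap.smulLeftCLM ℂ (fun ξ => dSymbol ξ ^ n * resSymbol ξ) (𝓕 ψ)) := by
  induction n with
  | zero => simp [resSchwartz]
  | succ n ih =>
    rw [Function.iterate_succ_apply', ih, lineDerivOp_fourierInv,
      SchwartzMap.smulLeftCLM_smulLeftCLM_apply hasTemperateGrowth_dSymbol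
        (hasTemperateGrowth_symbol n)]
    congr 3
    ext ξ
    simp only [Pi.mul_apply]
    ring

theorem dRes_toLp {n : ℕ} (hn : n ≤ 2) (ψ : 𝓢(ℝ, ℂ)) :
    dRes n hn (ψ.toLp 2) =
      ((fun φ : 𝓢(ℝ, ℂ) => (∂_{(1 : ℝ)} φ : 𝓢(ℝ, ℂ)))^[n] (resSchwartz ψ)).toLp 2 := by
  rw [dRes_apply, SchwartzMap.toLp_fourier_eq, mulCLM_toLp _ (hasTemperateGrowth_symbol n),
    SchwartzMap.toLp_fourierInv_eq, iterate_lineDerivOp_resSchwartz]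

theorem resSymbol_ne_zero (ξ : ℝ) : resSymbol ξ ≠ 0 := by
  rw [resSymbol, Complex.ofReal_ne_zero]
  positivity

theorem one_sub_dSymbol_sq_mul (ξ : ℝ) : (1 - dSymbol ξ ^ 2) * resSymbol ξ = 1 := by
  have h : 1 - dSymbol ξ ^ 2 = (1 + (2 * Real.pi * ξ) ^ 2 : ℂ) := by
    simp only [dSymbol, mul_pow, Complex.I_sq]; ring
  have h0 := resSymbol_ne_zero ξ
  rw [resSymbol_eq] at h0
  rw [h, resSymbol_eq, mul_inv_cancel₀ (fun h' => h0 (by rw [h', inv_zero]))]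

/-- The Fourier transform turns the weak derivative of `f ∈ H¹` into multiplication by `2πiξ`. -/
theorem fourier_dx {f : L2} (hf : MemH1 f) :
    (𝓕 (dx f) : L2) =ᵐ[volume] fun ξ => dSymbol ξ * (𝓕 f : L2) ξ := by
  -- Both sides times the resolvent symbol are in `L²`, where distributions separate points.
  have h0 : (𝓕 (dx f : 𝓢'(ℝ, ℂ)) : 𝓢'(ℝ, ℂ)) =
      TemperedDistribution.smulLeftCLM ℂ dSymbol (𝓕 (f : 𝓢'(ℝ, ℂ))) := by
    rw [dx_spec hf, TemperedDistribution.fourier_lineDerivOp_eq,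
      ← smul_apply, ← TemperedDistribution.smulLeftCLM_smul (by fun_prop)]
    congr 2
    ext ξ
    simp [dSymbol]
  have h1 : mulCLM _ (memLp_symbol (n := 0) (by norm_num)) (𝓕 (dx f)) =
      mulCLM _ (memLp_symbol (n := 1) (by norm_num)) (𝓕 f) := by
    apply toTemperedDistribution_injective
    rw [toTemperedDistribution_mulCLM _ (hasTemperateGrowth_symbol 0),
      toTemperedDistribution_mulCLM _ (hasTemperateGrowth_symbol 1),
      ← Lp.fourier_toTemperedDistribution_eq, ← Lp.fourier_toTemperedDistribution_eq, h0,
      TemperedDistribution.smulLeftCLM_smulLeftCLM_apply hasTemperateGrowth_dSymbol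
        (hasTemperateGrowth_symbol 0)]
    congr 2
    ext ξ
    simp only [Pi.mul_apply]
    ring
  filter_upwards [coeFn_mulCLM (memLp_symbol (n := 0) (by norm_num)) (𝓕 (dx f)),
    coeFn_mulCLM (memLp_symbol (n := 1) (by norm_num)) (𝓕 f)] with ξ h2 h3
  rw [h1, h3] at h2
  refine mul_left_cancel₀ (resSymbol_ne_zero ξ) ?_
  linear_combination -h2

theorem fourier_dxInv {f : L2} (hf : HasDxInv f) :
    (𝓕 f : L2) =ᵐ[volume] fun ξ => dSymbol ξ * (𝓕 (dxInv f) : L2) ξ := by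
  have h0 : (𝓕 (dxInv f) : L2) = hf.toLp (dxInvSymbol f) := by
    rw [dxInv, dif_pos hf]
    exact fourier_fourierInv_eq _
  have hξ : ∀ᵐ ξ : ℝ, ξ ≠ 0 := by simp [ae_iff, measure_singleton]
  rw [h0]
  filter_upwards [hf.coeFn_toLp, hξ] with ξ h1 h2
  have h3 : dSymbol ξ ≠ 0 := by
    simp [dSymbol, h2, Real.pi_ne_zero]
  rw [h1, dxInvSymbol]
  exact (mul_inv_cancel_left₀ h3 _).symm

/-- The pair `∂ₓ⁻¹f`, `f'` determines `Ψ = ∂ₓ⁻¹f - f' = (1 - ∂ₓ²) ∂ₓ⁻¹f ∈ L²`, from which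
`∂ₓ⁻¹f`, `f` and `f'` are recovered as `∂ₓⁿ (1 - ∂ₓ²)⁻¹ Ψ` with `n = 0, 1, 2`. -/
theorem dRes_eq {n : ℕ} (hn : n ≤ 2) {f u : L2} (hf : MemH1 f) (hf' : HasDxInv f)
    (hu : (𝓕 u : L2) =ᵐ[volume] fun ξ => dSymbol ξ ^ n * (𝓕 (dxInv f) : L2) ξ) :
    dRes n hn (dxInv f - dx f) = u := by
  rw [dRes_apply]
  rw [show u = 𝓕⁻ (𝓕 u) from (fourierInv_fourier_eq u).symm]
  congr 1
  refine Lp.ext ?_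
  rw [show (𝓕 (dxInv f - dx f) : L2) = 𝓕 (dxInv f) - 𝓕 (dx f) from
    map_sub (Lp.fourierTransformₗᵢ ℝ ℂ) _ _]
  filter_upwards [coeFn_mulCLM (memLp_symbol hn) (𝓕 (dxInv f) - 𝓕 (dx f)),
    Lp.coeFn_sub (𝓕 (dxInv f) : L2) (𝓕 (dx f)), hu, fourier_dx hf, fourier_dxInv hf']
    with ξ h1 h2 h3 h4 h5
  rw [h1, h2, Pi.sub_apply, h4, h5, h3]
  linear_combination dSymbol ξ ^ n * (𝓕 (dxInv f) : L2) ξ * one_sub_dSymbol_sq_mul ξ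

/-- Schwartz functions `φ` are dense for the graph norm: the triple `(∂ₓ⁻¹f, f, f')` is a limit in
`L²` of triples `(φ, φ', φ'')`. -/
theorem mem_closure_schwartz {f : L2} (hf : MemH1 f) (hf' : HasDxInv f) :
    (dxInv f, f, dx f) ∈ closure (Set.range fun φ : 𝓢(ℝ, ℂ) =>
      ((φ.toLp 2, (∂_{(1 : ℝ)} φ : 𝓢(ℝ, ℂ)).toLp 2,
        (∂_{(1 : ℝ)} (∂_{(1 : ℝ)} φ : 𝓢(ℝ, ℂ)) : 𝓢(ℝ, ℂ)).toLp 2) : L2 × L2 × L2)) := by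
  have h0 : dRes 0 (by norm_num) (dxInv f - dx f) = dxInv f := by
    refine dRes_eq _ hf hf' ?_
    simp
  have h1 : dRes 1 (by norm_num) (dxInv f - dx f) = f := by
    refine dRes_eq _ hf hf' ?_
    simpa using fourier_dxInv hf'
  have h2 : dRes 2 (by norm_num) (dxInv f - dx f) = dx f := by
    refine dRes_eq _ hf hf' ?_
    filter_upwards [fourier_dx hf, fourier_dxInv hf'] with ξ h4 h5
    rw [h4, h5]; ring
  have hc : Continuous fun u : L2 => (dRes 0 (by norm_num) u, dRes 1 (by norm_num) u,
    dRes 2 (by norm_num) u) := by fun_prop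
  have key := hc.range_subset_closure_image_dense
    (SchwartzMap.denseRange_toLpCLM (E := ℝ) (F := ℂ) (p := 2) (μ := volume) ENNReal.ofNat_ne_top)
    ⟨dxInv f - dx f, rfl⟩
  simp only [h0, h1, h2] at key
  refine closure_mono ?_ key
  rintro _ ⟨_, ⟨ψ, rfl⟩, rfl⟩
  refine ⟨resSchwartz ψ, ?_⟩
  simp only [SchwartzMap.toLpCLM_apply, dRes_toLp, Function.iterate_zero_apply,
    Function.iterate_succ_apply]

/-! ### Completing the square on Schwartz functions -/

/-- Completing the square: the flux `a |g'|² + 2b Re(g' ḡ) + q |g|²` differentiates to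
`|g'' + a g' + b g|²` minus the energy density with coefficients `a² - a' - 2b` and `b² - q'`. The
condition on `ab` cancels the cross term `Re(g' ḡ)`. -/
theorem hasDerivAt_energyFlux {a b q : ℝ → ℝ} {a' b' q' x : ℝ} {g f : ℝ → ℂ} {h : ℂ}
    (ha : HasDerivAt a a' x) (hb : HasDerivAt b b' x) (hq : HasDerivAt q q' x)
    (hg : HasDerivAt g (f x) x) (hf : HasDerivAt f h x) (hab : a x * b x = q x + b') :
    HasDerivAt (fun y => a y * ‖f y‖ ^ 2 + 2 * b y * inner ℝ (f y) (g y) + q y * ‖g y‖ ^ 2)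
      (‖h + a x • f x + b x • g x‖ ^ 2
        - (‖h‖ ^ 2 + (a x ^ 2 - a' - 2 * b x) * ‖f x‖ ^ 2 + (b x ^ 2 - q') * ‖g x‖ ^ 2)) x := by
  refine (((ha.mul hf.norm_sq).add ((hb.const_mul 2).mul (hf.inner ℝ hg))).add
    (hq.mul hg.norm_sq)).congr_deriv ?_
  simp only [norm_add_sq_real, norm_smul, inner_add_left, inner_smul_left, inner_smul_right,
    real_inner_self_eq_norm_sq, real_inner_comm h, real_inner_comm (f x) (g x), mul_pow,
    Real.norm_eq_abs, sq_abs, RCLike.conj_to_real]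
  linear_combination (-2 * inner ℝ (f x) (g x)) * hab

/-- The form `∫ ‖φ''‖² + V ‖φ'‖² + μ ‖φ‖²` is nonnegative on Schwartz functions when its density is
`‖φ'' + a φ' + b φ‖²` up to an exact derivative. -/
theorem integral_nonneg_of_sq_factorization {a b q a' b' q' V : ℝ → ℝ} {μ Ka Kb Kq KV : ℝ}
    (ha : ∀ x, HasDerivAt a (a' x) x) (hb : ∀ x, HasDerivAt b (b' x) x)
    (hq : ∀ x, HasDerivAt q (q' x) x) (hKa : ∀ x, ‖a x‖ ≤ Ka) (hKb : ∀ x, ‖b x‖ ≤ Kb)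
    (hKq : ∀ x, ‖q x‖ ≤ Kq) (hV : Continuous V) (hKV : ∀ x, ‖V x‖ ≤ KV)
    (hab : ∀ x, a x * b x = q x + b' x) (hVeq : ∀ x, V x = a x ^ 2 - a' x - 2 * b x)
    (hμ : ∀ x, μ = b x ^ 2 - q' x) (φ : 𝓢(ℝ, ℂ)) :
    0 ≤ ∫ x, (‖(∂_{(1 : ℝ)} (∂_{(1 : ℝ)} φ : 𝓢(ℝ, ℂ)) : 𝓢(ℝ, ℂ)) x‖ ^ 2
      + V x * ‖(∂_{(1 : ℝ)} φ : 𝓢(ℝ, ℂ)) x‖ ^ 2 + μ * ‖φ x‖ ^ 2) := by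
  have hd : ∀ (χ : 𝓢(ℝ, ℂ)) (x : ℝ), HasDerivAt χ ((∂_{(1 : ℝ)} χ : 𝓢(ℝ, ℂ)) x) x := by
    intro χ x
    rw [SchwartzMap.lineDerivOp_apply_eq_fderiv, fderiv_apply_one_eq_deriv]
    exact χ.hasDerivAt x
  set f : 𝓢(ℝ, ℂ) := ∂_{(1 : ℝ)} φ with hf
  set h : 𝓢(ℝ, ℂ) := ∂_{(1 : ℝ)} f with hh
  have hac : Continuous a := continuous_iff_continuousAt.2 fun x => (ha x).continuousAt
  have hbc : Continuous b := continuous_iff_continuousAt.2 fun x => (hb x).continuousAt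
  have hqc : Continuous q := continuous_iff_continuousAt.2 fun x => (hq x).continuousAt
  have hsq : ∀ χ : 𝓢(ℝ, ℂ), Integrable (fun x => ‖χ x‖ ^ 2) := fun χ =>
    (χ.memLp 2).integrable_norm_pow two_ne_zero
  have hmul : ∀ {w : ℝ → ℝ} {K : ℝ} {u : ℝ → ℝ}, Continuous w → (∀ x, ‖w x‖ ≤ K) →
      Integrable u → Integrable fun x => w x * u x := fun hw hK hu =>
    hu.bdd_mul hw.aestronglyMeasurable (Filter.Eventually.of_forall hK)
  have hin : Integrable fun x => inner ℝ (f x) (φ x) := by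
    refine ((((hsq (f + φ)).sub (hsq f)).sub (hsq φ)).div_const 2).congr
      (Filter.Eventually.of_forall fun x => ?_)
    simp only [Pi.sub_apply, add_apply, norm_add_sq_real]
    ring
  have hN : Integrable fun x => ‖h x‖ ^ 2 + V x * ‖f x‖ ^ 2 + μ * ‖φ x‖ ^ 2 :=
    ((hsq h).add (hmul hV hKV (hsq f))).add ((hsq φ).const_mul μ)
  have hsmul : ∀ {w : ℝ → ℝ} {K : ℝ} (χ : 𝓢(ℝ, ℂ)), Continuous w → (∀ x, ‖w x‖ ≤ K) →
      MemLp (fun x => w x • χ x) 2 := fun χ hw hK =>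
    (χ.memLp 2).smul (memLp_top_of_bound hw.aestronglyMeasurable _
      (Filter.Eventually.of_forall hK))
  have hS : Integrable fun x => ‖h x + a x • f x + b x • φ x‖ ^ 2 :=
    (((h.memLp 2).add (hsmul f hac hKa)).add (hsmul φ hbc hKb)).integrable_norm_pow two_ne_zero
  have hF : Integrable fun x => a x * ‖f x‖ ^ 2 + 2 * b x * inner ℝ (f x) (φ x)
      + q x * ‖φ x‖ ^ 2 := by
    refine ((hmul hac hKa (hsq f)).add ?_).add (hmul hqc hKq (hsq φ))
    simpa only [mul_assoc] using (hmul hbc hKb hin).const_mul 2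
  have h0 := integral_eq_zero_of_hasDerivAt_of_integrable
    (fun x => (hasDerivAt_energyFlux (ha x) (hb x) (hq x) (hd φ x) (hd f x) (hab x)).congr_deriv
      (by rw [← hVeq x, ← hμ x]; rfl)) (hS.sub hN) hF
  rw [integral_sub' hS hN, sub_eq_zero] at h0
  rw [← h0]
  exact integral_nonneg fun x => by positivity

/-! ### The quadratic form on `L²` -/

/-- The form `‖h‖² + ∫ V ‖f‖² + μ ‖g‖²` on `(g, f, h) ∈ L² × L² × L²`. -/
def energy (V : ℝ → ℂ) (hV : MemLp V ⊤ volume) (μ : ℝ) (p : L2 × L2 × L2) : ℝ :=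
  ‖p.2.2‖ ^ 2 + (inner ℂ p.2.1 (mulCLM V hV p.2.1)).re + μ * ‖p.1‖ ^ 2

theorem norm_sq_eq_integral (u : L2) : ‖u‖ ^ 2 = ∫ x, ‖u x‖ ^ 2 := by
  have h := @inner_self_eq_norm_sq ℂ _ _ _ _ u
  rw [← h, L2.inner_def, ← integral_re (L2.integrable_inner u u)]
  simp only [inner_self_eq_norm_sq]

theorem integrable_norm_sq (u : L2) : Integrable fun x => ‖u x‖ ^ 2 :=
  (Lp.memLp u).integrable_norm_pow two_ne_zero

theorem inner_mulCLM_ofReal {V : ℝ → ℝ} (hV : MemLp (fun x => (V x : ℂ)) ⊤ volume) (u : L2) :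
    Integrable (fun x => V x * ‖u x‖ ^ 2) ∧
    (inner ℂ u (mulCLM _ hV u)).re = ∫ x, V x * ‖u x‖ ^ 2 := by
  have h : (fun x => RCLike.re (inner ℂ (u x) (mulCLM _ hV u x))) =ᵐ[volume]
      fun x => V x * ‖u x‖ ^ 2 := by
    filter_upwards [coeFn_mulCLM hV u] with x hx
    rw [hx, ← smul_eq_mul, inner_smul_right, inner_self_eq_norm_sq_to_K]
    simp [← Complex.ofReal_pow]
  refine ⟨(L2.integrable_inner (𝕜 := ℂ) u (mulCLM _ hV u)).re.congr h, ?_⟩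
  rw [L2.inner_def, ← integral_congr_ae h, integral_re (L2.integrable_inner _ _)]
  rfl

theorem energy_eq_integral {V : ℝ → ℝ} (hV : MemLp (fun x => (V x : ℂ)) ⊤ volume) (μ : ℝ)
    (g f h : L2) :
    energy _ hV μ (g, f, h) = ∫ x, (‖h x‖ ^ 2 + V x * ‖f x‖ ^ 2 + μ * ‖g x‖ ^ 2) := by
  obtain ⟨h1, h2⟩ := inner_mulCLM_ofReal hV f
  have h3 : Integrable fun x => ‖h x‖ ^ 2 + V x * ‖f x‖ ^ 2 := (integrable_norm_sq h).add h1
  rw [integral_add h3 ((integrable_norm_sq g).const_mul μ),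
    integral_add (integrable_norm_sq h) h1, integral_const_mul, energy, h2,
    norm_sq_eq_integral, norm_sq_eq_integral g]

theorem continuous_energy {V : ℝ → ℂ} (hV : MemLp V ⊤ volume) (μ : ℝ) :
    Continuous (energy V hV μ) := by
  unfold energy; fun_prop

/-- Nonnegativity of the form passes from Schwartz functions to `H¹` by density. -/
theorem energy_nonneg {V : ℝ → ℝ} (hV : MemLp (fun x => (V x : ℂ)) ⊤ volume) {μ : ℝ}
    (hφ : ∀ φ : 𝓢(ℝ, ℂ), 0 ≤ ∫ x, (‖(∂_{(1 : ℝ)} (∂_{(1 : ℝ)} φ : 𝓢(ℝ, ℂ)) : 𝓢(ℝ, ℂ)) x‖ ^ 2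
      + V x * ‖(∂_{(1 : ℝ)} φ : 𝓢(ℝ, ℂ)) x‖ ^ 2 + μ * ‖φ x‖ ^ 2))
    {f : L2} (hf : MemH1 f) (hf' : HasDxInv f) :
    0 ≤ energy _ hV μ (dxInv f, f, dx f) := by
  refine closure_minimal (t := {p | 0 ≤ energy _ hV μ p}) ?_
    (isClosed_le continuous_const (continuous_energy hV μ)) (mem_closure_schwartz hf hf')
  rintro _ ⟨φ, rfl⟩
  rw [Set.mem_ofPred_eq, energy_eq_integral]
  refine (hφ φ).trans_eq (integral_congr_ae ?_)
  filter_upwards [φ.coeFn_toLp 2 volume, (∂_{(1 : ℝ)} φ : 𝓢(ℝ, ℂ)).coeFn_toLp 2 volume,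
    (∂_{(1 : ℝ)} (∂_{(1 : ℝ)} φ : 𝓢(ℝ, ℂ)) : 𝓢(ℝ, ℂ)).coeFn_toLp 2 volume] with x h1 h2 h3
  rw [h1, h2, h3]

/-! ### The factorization of the critical form -/

theorem hasDerivAt_tanh_mul_half (s x : ℝ) :
    HasDerivAt (fun y => Real.tanh (s * y / 2)) (s / 2 * (1 - Real.tanh (s * x / 2) ^ 2)) x := by
  have hc : Real.cosh (s * x / 2) ≠ 0 := (Real.cosh_pos _).ne'
  have hl : HasDerivAt (fun y => s * y / 2) (s / 2) x := by
    simpa using ((hasDerivAt_id x).const_mul s).div_const 2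
  have h := hl.sinh.div hl.cosh hc
  simp only [Real.tanh_eq_sinh_div_cosh]
  refine h.congr_deriv ?_
  field_simp

theorem Qc_eq_tanh {c : ℝ} (x : ℝ) :
    Qc c x = 3 * c * (1 - Real.tanh (√c * x / 2) ^ 2) := by
  have hc : Real.cosh (√c * x / 2) ≠ 0 := (Real.cosh_pos _).ne'
  rw [Qc, Q, Real.tanh_eq_sinh_div_cosh, div_pow, Real.sinh_sq]
  field_simp
  ring

/-- With `t = tanh(x/2)`, the function `t² - √3 t + 1` times
`-(1/3) e^{(1+√3)x/2} (1 - t)` is the Wronskian of `u = e^{x/2} t (1 - t)` and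
`v = e^{√3x/2} (t - 1/√3) (t - 2/√3)`. These are the solutions of the critical equation
`y'''' - y'' + (Q y')' + (3/16) y = 0` that decay at `-∞`. -/
def wronsk (t : ℝ) : ℝ := t ^ 2 - √3 * t + 1

theorem sqrt_three_sq : √(3 : ℝ) ^ 2 = 3 := Real.sq_sqrt (by norm_num)

/-- The Wronskian has no zero, since the discriminant of `t² - √3 t + 1` is `-1`. -/
theorem wronsk_pos (t : ℝ) : 0 < wronsk t := by
  unfold wronsk
  nlinarith [sq_nonneg (2 * t - √3), sqrt_three_sq]

/-- The coefficient of `∂ₓ` in the second-order operator `∂ₓ² + A ∂ₓ + B` with kernel spanned by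
`u` and `v` (see `wronsk`), as a function of `t = tanh(x/2)`. -/
def coefA (t : ℝ) : ℝ := t * (3 * t ^ 2 - 3 * √3 * t + 2) / (2 * wronsk t)

/-- The zeroth-order coefficient of the operator with kernel spanned by `u` and `v`, as a function
of `t = tanh(x/2)`. -/
def coefB (t : ℝ) : ℝ := (3 - 2 * √3 * t) / (4 * wronsk t)

/-- The coefficient of `|φ|²` in the flux that is left over after completing the square. It equals
`A B - B'`, where `'` is the `x`-derivative; cancelling a factor `t² - √3 t + 1` gives this form. -/
def coefQ (t : ℝ) : ℝ := (-4 * √3 * t ^ 2 + 9 * t - √3) / (8 * wronsk t)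

theorem hasDerivAt_wronsk (t : ℝ) : HasDerivAt wronsk (2 * t - √3) t := by
  have h := (((hasDerivAt_id t).pow 2).sub ((hasDerivAt_id t).const_mul √3)).add_const 1
  refine h.congr_deriv ?_
  simp

theorem hasDerivAt_coefA (t : ℝ) : HasDerivAt coefA
    (((9 * t ^ 2 - 6 * √3 * t + 2) * (2 * wronsk t)
      - t * (3 * t ^ 2 - 3 * √3 * t + 2) * (2 * (2 * t - √3))) / (2 * wronsk t) ^ 2) t := by
  have hn : HasDerivAt (fun t : ℝ => t * (3 * t ^ 2 - 3 * √3 * t + 2))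
      (9 * t ^ 2 - 6 * √3 * t + 2) t := by
    have h := (hasDerivAt_id t).mul (((((hasDerivAt_id t).pow 2).const_mul 3).sub
      ((hasDerivAt_id t).const_mul (3 * √3))).add_const 2)
    refine h.congr_deriv ?_
    simp
    ring
  exact hn.div ((hasDerivAt_wronsk t).const_mul 2) (by have := wronsk_pos t; positivity)

theorem hasDerivAt_coefB (t : ℝ) : HasDerivAt coefB
    (((-2 * √3) * (4 * wronsk t) - (3 - 2 * √3 * t) * (4 * (2 * t - √3)))
      / (4 * wronsk t) ^ 2) t := by
  have hn : HasDerivAt (fun t : ℝ => 3 - 2 * √3 * t) (-2 * √3) t := by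
    have h := ((hasDerivAt_id t).const_mul (2 * √3)).const_sub 3
    refine h.congr_deriv ?_
    ring
  exact hn.div ((hasDerivAt_wronsk t).const_mul 4) (by have := wronsk_pos t; positivity)

theorem hasDerivAt_coefQ (t : ℝ) : HasDerivAt coefQ
    (((-8 * √3 * t + 9) * (8 * wronsk t)
      - (-4 * √3 * t ^ 2 + 9 * t - √3) * (8 * (2 * t - √3))) / (8 * wronsk t) ^ 2) t := by
  have hn : HasDerivAt (fun t : ℝ => -4 * √3 * t ^ 2 + 9 * t - √3) (-8 * √3 * t + 9) t := by
    have h := ((((hasDerivAt_id t).pow 2).const_mul (-4 * √3)).add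
      ((hasDerivAt_id t).const_mul 9)).sub_const √3
    refine h.congr_deriv ?_
    simp
    ring
  exact hn.div ((hasDerivAt_wronsk t).const_mul 8) (by have := wronsk_pos t; positivity)

/-- The coefficient of `|φ'|²` in the factorized form is `1 - Q`; here `(1 - t²)/2 · d/dt` is the
`x`-derivative. -/
theorem coefA_riccati (t : ℝ) :
    coefA t ^ 2 - (1 - t ^ 2) / 2 * deriv coefA t - 2 * coefB t = 1 - 3 * (1 - t ^ 2) := by
  have hw := (wronsk_pos t).ne'
  have h3 := sqrt_three_sq
  rw [(hasDerivAt_coefA t).deriv, coefA, coefB]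
  field_simp
  unfold wronsk
  ring_nf
  simp only [h3]
  ring

/-- The coefficient of `|φ|²` in the factorized form is the critical value `3/16`. -/
theorem coefB_riccati (t : ℝ) :
    coefB t ^ 2 - (1 - t ^ 2) / 2 * deriv coefQ t = 3 / 16 := by
  have hw := (wronsk_pos t).ne'
  have h3 := sqrt_three_sq
  rw [(hasDerivAt_coefQ t).deriv, coefB]
  field_simp
  unfold wronsk
  ring_nf
  simp only [h3]
  ring

theorem coefA_mul_coefB (t : ℝ) :
    coefA t * coefB t = coefQ t + (1 - t ^ 2) / 2 * deriv coefB t := by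
  have hw := (wronsk_pos t).ne'
  have h3 := sqrt_three_sq
  rw [(hasDerivAt_coefB t).deriv, coefQ, coefB, coefA]
  field_simp
  unfold wronsk
  ring_nf
  simp only [h3]
  ring

theorem hasDerivAt_comp_tanh {R : ℝ → ℝ} (hR : Differentiable ℝ R) (s x : ℝ) :
    HasDerivAt (fun y => R (Real.tanh (s * y / 2)))
      (s * ((1 - Real.tanh (s * x / 2) ^ 2) / 2 * deriv R (Real.tanh (s * x / 2)))) x := by
  refine ((hR _).hasDerivAt.comp x (hasDerivAt_tanh_mul_half s x)).congr_deriv ?_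
  ring

theorem exists_bound_comp_tanh {R : ℝ → ℝ} (hR : Differentiable ℝ R) :
    ∃ K, ∀ y, ‖R (Real.tanh y)‖ ≤ K := by
  obtain ⟨K, hK⟩ := isCompact_Icc.exists_bound_of_continuousOn (s := Set.Icc (-1 : ℝ) 1)
    hR.continuous.continuousOn
  exact ⟨K, fun y => hK _ ⟨(Real.neg_one_lt_tanh y).le, (Real.tanh_lt_one y).le⟩⟩

theorem differentiable_coefA : Differentiable ℝ coefA :=
  fun t => (hasDerivAt_coefA t).differentiableAt

theorem differentiable_coefB : Differentiable ℝ coefB :=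
  fun t => (hasDerivAt_coefB t).differentiableAt

theorem differentiable_coefQ : Differentiable ℝ coefQ :=
  fun t => (hasDerivAt_coefQ t).differentiableAt

/-! ### Bounds for the form with potential `c - Q_c` -/

theorem continuous_Qc (c : ℝ) : Continuous (Qc c) := by
  rw [show Qc c = fun x => 3 * c * (1 - Real.tanh (√c * x / 2) ^ 2) from funext Qc_eq_tanh]
  have h : Continuous fun x => Real.tanh (√c * x / 2) :=
    continuous_iff_continuousAt.2 fun x => (hasDerivAt_tanh_mul_half _ x).continuousAt
  fun_prop

theorem Qc_nonneg {c : ℝ} (hc : 0 ≤ c) (x : ℝ) : 0 ≤ Qc c x := by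
  rw [Qc, Q]; positivity

theorem Qc_le {c : ℝ} (hc : 0 ≤ c) (x : ℝ) : Qc c x ≤ 3 * c := by
  rw [Qc_eq_tanh]
  nlinarith [mul_nonneg hc (sq_nonneg (Real.tanh (√c * x / 2)))]

theorem norm_sub_Qc_le {c : ℝ} (hc : 0 ≤ c) (x : ℝ) : ‖c - Qc c x‖ ≤ 2 * c := by
  rw [Real.norm_eq_abs, abs_le]
  constructor <;> linarith [Qc_le hc x, Qc_nonneg hc x]

theorem memLp_sub_Qc {c : ℝ} (hc : 0 ≤ c) :
    MemLp (fun x => ((c - Qc c x : ℝ) : ℂ)) ⊤ volume := by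
  refine memLp_top_of_bound (Complex.continuous_ofReal.comp
    (continuous_const.sub (continuous_Qc c))).aestronglyMeasurable (2 * c)
    (Filter.Eventually.of_forall fun x => ?_)
  rw [Complex.norm_real]
  exact norm_sub_Qc_le hc x

/-- Nonnegativity of the critical form: the factorization for `c = 1`, rescaled by `√c`. -/
theorem energy_Qc_nonneg {c : ℝ} (hc : 0 ≤ c) {f : L2} (hf : MemH1 f) (hf' : HasDxInv f) :
    0 ≤ energy _ (memLp_sub_Qc hc) (3 / 16 * c ^ 2) (dxInv f, f, dx f) := by
  refine energy_nonneg _ ?_ hf hf'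
  obtain ⟨Ka, hKa⟩ := exists_bound_comp_tanh differentiable_coefA
  obtain ⟨Kb, hKb⟩ := exists_bound_comp_tanh differentiable_coefB
  obtain ⟨Kq, hKq⟩ := exists_bound_comp_tanh differentiable_coefQ
  set s := √c with hs
  have hsc : s ^ 2 = c := Real.sq_sqrt hc
  have hbd : ∀ {z : ℝ} {K : ℝ} (n : ℕ), ‖z‖ ≤ K → ‖s ^ n * z‖ ≤ ‖s ^ n‖ * K := fun n hz => by
    rw [norm_mul]; gcongr
  refine integral_nonneg_of_sq_factorization
    (fun x => (hasDerivAt_comp_tanh differentiable_coefA s x).const_mul (s ^ 1))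
    (fun x => (hasDerivAt_comp_tanh differentiable_coefB s x).const_mul (s ^ 2))
    (fun x => (hasDerivAt_comp_tanh differentiable_coefQ s x).const_mul (s ^ 3))
    (fun x => hbd 1 (hKa _)) (fun x => hbd 2 (hKb _)) (fun x => hbd 3 (hKq _))
    (continuous_const.sub (continuous_Qc c)) (norm_sub_Qc_le hc)
    (fun x => ?_) (fun x => ?_) (fun x => ?_)
  · linear_combination s ^ 3 * coefA_mul_coefB (Real.tanh (s * x / 2))
  · rw [Qc_eq_tanh, ← hs, ← hsc]
    linear_combination -s ^ 2 * coefA_riccati (Real.tanh (s * x / 2))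
  · rw [← hsc]
    linear_combination -s ^ 4 * coefB_riccati (Real.tanh (s * x / 2))

/-- The interpolation inequality `‖f‖² ≤ ‖f'‖ ‖∂ₓ⁻¹f‖`, in its additive form. -/
theorem norm_sq_le_interpolation {f : L2} (hf : MemH1 f) (hf' : HasDxInv f) (b : ℝ) :
    2 * b * ‖f‖ ^ 2 ≤ ‖dx f‖ ^ 2 + b ^ 2 * ‖dxInv f‖ ^ 2 := by
  have hV : MemLp (fun _ : ℝ => ((-2 * b : ℝ) : ℂ)) ⊤ volume := memLp_top_const _
  -- The form with density `‖φ'' + b φ‖²`.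
  have h := energy_nonneg hV (μ := b ^ 2) (fun φ => integral_nonneg_of_sq_factorization
    (fun x => hasDerivAt_const x (0 : ℝ)) (fun x => hasDerivAt_const x b)
    (fun x => hasDerivAt_const x (0 : ℝ)) (fun _ => le_rfl) (fun _ => le_rfl) (fun _ => le_rfl)
    continuous_const (fun _ => le_rfl) (by simp) (by simp) (by simp) φ) hf hf'
  have h2 := (inner_mulCLM_ofReal hV f).2
  rw [integral_const_mul, ← norm_sq_eq_integral] at h2
  rw [energy, h2] at h
  linarith

theorem B_self_eq {c : ℝ} (hc : 0 ≤ c) (k : ℤ) (f : L2) :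
    B c k f f = 2 * energy _ (memLp_sub_Qc hc) ((k : ℝ) ^ 2) (dxInv f, f, dx f) := by
  have hz : ∀ z : ℂ, (z * star z).re = ‖z‖ ^ 2 := fun z => by
    rw [Complex.star_def, Complex.mul_conj, Complex.ofReal_re, Complex.normSq_eq_norm_sq]
  rw [B, energy_eq_integral]
  congr 2
  ext x
  simp only [hz]
  ring

/-- A crude lower bound from `Q_c ≤ 3c`, which retains the full `‖f'‖²`. -/
theorem le_energy_Qc {c : ℝ} (hc : 0 ≤ c) (μ : ℝ) (f : L2) :
    ‖dx f‖ ^ 2 - 2 * c * ‖f‖ ^ 2 + μ * ‖dxInv f‖ ^ 2 ≤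
      energy _ (memLp_sub_Qc hc) μ (dxInv f, f, dx f) := by
  obtain ⟨h1, h2⟩ := inner_mulCLM_ofReal (memLp_sub_Qc hc) f
  have h3 : -(2 * c) * ‖f‖ ^ 2 ≤ ∫ x, (c - Qc c x) * ‖f x‖ ^ 2 := by
    rw [norm_sq_eq_integral, ← integral_const_mul]
    refine integral_mono ((integrable_norm_sq f).const_mul _) h1 fun x => ?_
    have := Qc_le hc x
    dsimp only
    gcongr
    linarith
  rw [energy, h2]
  dsimp only
  linarith

end KPI

end

/-! ### Coercivity -/

theorem mainTheorem3 (c₀ : ℝ) (hc₀ : c₀ < 4 / Real.sqrt 3) :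
    ∃ C : ℝ, 0 < C ∧
      ∀ c : ℝ, 0 < c → c ≤ c₀ → ∀ k : ℤ, k ≠ 0 →
        ∀ f : KPI.L2, KPI.MemH1 f → KPI.HasDxInv f →
          C * (KPI.normH1Sq f + (k : ℝ) ^ 2 * ‖KPI.dxInv f‖ ^ 2) ≤ KPI.B c k f f := by
  rcases le_or_gt c₀ 0 with h0 | h0
  · exact ⟨1, one_pos, fun c hc hcc => absurd hcc (not_le.2 (h0.trans_lt hc))⟩
  obtain ⟨δ, hδ, hδ'⟩ : ∃ δ : ℝ, 0 < δ ∧ 3 / 16 * c₀ ^ 2 = 1 - δ := by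
    refine ⟨1 - 3 / 16 * c₀ ^ 2, ?_, by ring⟩
    rw [lt_div_iff₀ (by positivity)] at hc₀
    nlinarith [KPI.sqrt_three_sq, mul_pos h0 (Real.sqrt_pos.2 (three_pos (α := ℝ)))]
  -- A fraction `ε` of the critical form is kept to control `‖f'‖²`; it is small enough for the
  -- error `ε b² / 2 · ‖∂ₓ⁻¹f‖²` of interpolating `b ‖f‖²` to cost only half of `δ`.
  set b : ℝ := 2 * c₀ + 1 with hb
  have hb0 : 0 < b := by positivity
  obtain ⟨ε, hε, hε1, hεδ⟩ : ∃ ε : ℝ, 0 < ε ∧ ε ≤ 1 ∧ ε * b ^ 2 ≤ δ :=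
    ⟨min 1 (δ / b ^ 2), by positivity, min_le_left _ _,
      (le_div_iff₀ (by positivity)).1 (min_le_right _ _)⟩
  refine ⟨min ε δ, lt_min hε hδ, fun c hc hcc k hk f hf hf' => ?_⟩
  have hN := KPI.energy_Qc_nonneg hc.le hf hf'
  have hl := KPI.le_energy_Qc hc.le (3 / 16 * c ^ 2) f
  have hi := KPI.norm_sq_le_interpolation hf hf' b
  have hE : KPI.energy _ (KPI.memLp_sub_Qc hc.le) ((k : ℝ) ^ 2) (KPI.dxInv f, f, KPI.dx f) =
      KPI.energy _ (KPI.memLp_sub_Qc hc.le) (3 / 16 * c ^ 2) (KPI.dxInv f, f, KPI.dx f)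
        + ((k : ℝ) ^ 2 - 3 / 16 * c ^ 2) * ‖KPI.dxInv f‖ ^ 2 := by
    simp only [KPI.energy]; ring
  rw [KPI.B_self_eq hc.le, hE, KPI.normH1Sq]
  have hk1 : (1 : ℝ) ≤ (k : ℝ) ^ 2 := by
    exact_mod_cast Int.one_le_abs (pow_ne_zero 2 hk) |>.trans_eq (abs_of_nonneg (sq_nonneg k))
  set N := KPI.energy _ (KPI.memLp_sub_Qc hc.le) (3 / 16 * c ^ 2) (KPI.dxInv f, f, KPI.dx f)
  have hG : 0 ≤ ‖KPI.dxInv f‖ ^ 2 := by positivity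
  have hF : 0 ≤ ‖f‖ ^ 2 := by positivity
  have hH : 0 ≤ ‖KPI.dx f‖ ^ 2 := by positivity
  set G := ‖KPI.dxInv f‖ ^ 2
  set F := ‖f‖ ^ 2
  set H := ‖KPI.dx f‖ ^ 2
  have hc2 : c ^ 2 ≤ c₀ ^ 2 := by gcongr
  have hGk : G ≤ (k : ℝ) ^ 2 * G := le_mul_of_one_le_left hG hk1
  have hμ : δ * ((k : ℝ) ^ 2 * G) ≤ ((k : ℝ) ^ 2 - 3 / 16 * c ^ 2) * G := by
    rw [← mul_assoc]
    gcongr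
    nlinarith
  have hN1 : F + H / 2 - b ^ 2 / 2 * G ≤ N := by
    have h1 : 0 ≤ 3 / 16 * c ^ 2 * G := by positivity
    have h2 : 2 * c * F ≤ 2 * c₀ * F := by gcongr
    linear_combination hl + hi / 2 + h1 + h2
  have hN2 : ε * (F + H / 2 - b ^ 2 / 2 * G) ≤ N := by
    nlinarith [mul_le_mul_of_nonneg_left hN1 hε.le, mul_nonneg (sub_nonneg.2 hε1) hN]
  have hG2 : ε * b ^ 2 * G ≤ δ * ((k : ℝ) ^ 2 * G) := by gcongr
  calc min ε δ * (F + H + (k : ℝ) ^ 2 * G)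
      = min ε δ * (F + H) + min ε δ * ((k : ℝ) ^ 2 * G) := by ring
    _ ≤ ε * (F + H) + δ * ((k : ℝ) ^ 2 * G) := by
      gcongr
      · exact min_le_left _ _
      · exact min_le_right _ _
    _ ≤ 2 * (N + ((k : ℝ) ^ 2 - 3 / 16 * c ^ 2) * G) := by
      have := mul_nonneg hε.le hF
      linear_combination 2 * hN2 + 2 * hμ + hG2 + this
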